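/- Let $r\ge 1$ be an integer. Write $y\in\mathbb R^{1+r}$ as $y=(\dot y;\bar y)$ with $\dot y\in\mathbb R$ its first component and $\bar y\in\mathbb R^{r}$ the remaining ones, let $\|\cdot\|$ and $\langle\cdot,\cdot\rangle$ be the Euclidean norm and inner product, and let $\mathcal Q=\{y\in\mathbb R^{1+r}\mid \dot y\ge\|\bar y\|\}$ be the second-order cone. For a subset $\Omega$ of a Euclidean space and $u\in\Omega$, let $\widehat N_\Omega(u)=\{p\mid\langle p,u'-u\rangle\le o(\|u'-u\|)\ \text{for } u'\in\Omega\}$ be the regular normal cone, and let $N_\Omega(u)$ be the limiting normal cone, i.e. the set of all limits $\lim_k p_k$ with $p_k\in\widehat N_\Omega(u_k)$, $u_k\in\Omega$, $u_k\to u$; both are empty if $u\notin\Omega$. For a set-valued map $\Psi$ and $v\in\Psi(u)$, the limiting coderivative is $D^*\Psi(u,v)(q)=\{p\mid (p,-q)\in N_{\operatorname{gph}\Psi}(u,v)\}$. **Lemma.** Let $u\in\mathcal Q$ and $v\in N_{\mathcal Q}(u)$. 1. If $u=0$ and $v\in-\operatorname{int}\mathcal Q$, then $D^*N_{\mathcal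 Q}(u,v)(0)=\mathbb R^{1+r}$, and $D^*N_{\mathcal Q}(u,v)(q)=\emptyset$ for every $q\neq0$. 2. If $u\in\operatorname{int}\mathcal Q$ and $v=0$, then $D^*N_{\mathcal Q}(u,v)(q)=\{0\}$ for every $q\in\mathbb R^{1+r}$. 3. If $u\in\operatorname{bdry}\mathcal Q\setminus\{0\}$ and $v\in-\operatorname{bdry}\mathcal Q\setminus\{0\}$, then for every $q\in\mathbb R^{1+r}$ $$D^*N_{\mathcal Q}(u,v)(q)=\begin{cases}\left\{\left(\frac{\dot v}{\dot u}\dot q-\tau;\,-\frac{\dot v}{\dot u}\bar q+\tau\frac{\bar u}{\|\bar u\|}\right)\ \middle|\ \tau\in\mathbb R\right\},&\text{if }\langle q,v\rangle=0,\\ \emptyset,&\text{otherwise.}\end{cases}$$ 4. If $u\in\operatorname{bdry}\mathcal Q\setminus\{0\}$ and $v=0$, put $n=\left(1;-\frac{\bar u}{\|\bar u\|}\right)$. Then for every $q\in\mathbb R^{1+r}$ $$D^*N_{\mathcal Q}(u,v)(q)=\begin{cases}\{0\},&\text{if }\langle n,q\rangle>0,\\ \{\tau n\mid\tau\in\mathbb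 R\},&\text{if }\langle n,q\rangle=0,\\ \{\tau n\mid\tau\le0\},&\text{if }\langle n,q\rangle<0.\end{cases}$$ 5. If $u=0$ and $v\in-\operatorname{bdry}\mathcal Q\setminus\{0\}$, then for every $q\in\mathbb R^{1+r}$: if $q=\tau\left(1;\frac{\bar v}{\|\bar v\|}\right)$ for some $\tau\in\mathbb R$, then $$D^*N_{\mathcal Q}(u,v)(q)=\begin{cases}\{p\in\mathbb R^{1+r}\mid\langle p,q\rangle=0\},&\text{if }\tau>0,\\ \mathbb R^{1+r},&\text{if }\tau=0,\\ \{p\in\mathbb R^{1+r}\mid\langle p,q\rangle\ge0\},&\text{if }\tau<0;\end{cases}$$ if $q$ is not of this form, then $D^*N_{\mathcal Q}(u,v)(q)=\emptyset$. 6. If $u=v=0$, then: - (6a) $D^*N_{\mathcal Q}(0,0)(0)=\mathbb R^{1+r}$; - (6b) $p\in D^*N_{\mathcal Q}(0,0)(q)$ whenever $p,q\in-\mathcal Q$; - (6c) $p\in D^*N_{\mathcal Q}(0,0)(q)$ whenever $p\in-\operatorname{bdry}\mathcal Q\setminus\{0\}$, $q\in\mathbb R^{1+r}$ and $\langle p,q\rangle\ge0$;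 - (6d) $p\in D^*N_{\mathcal Q}(0,0)(q)$ whenever $p\in\mathbb R^{1+r}$, $q\in-\operatorname{bdry}\mathcal Q\setminus\{0\}$ and $\langle p,q\rangle\ge0$; - (6e) $0\in D^*N_{\mathcal Q}(0,0)(q)$ for every $q\in\mathbb R^{1+r}$. -/

import Mathlib

open Filter Topology
open scoped Pointwise

section NormalCones

variable {E : Type*} [NormedAddCommGroup E] [InnerProductSpace ℝ E]

/-- The regular (Fréchet) normal cone to `Ω` at `u`: the vectors `p` with
`⟪p, u' - u⟫ ≤ o(‖u' - u‖)` for `u' ∈ Ω`. It is empty when `u ∉ Ω`. -/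
def regularNormalCone (Ω : Set E) (u : E) : Set E :=
  {p | u ∈ Ω ∧ ∀ ε : ℝ, 0 < ε → ∀ᶠ u' in 𝓝[Ω] u, inner ℝ p (u' - u) ≤ ε * ‖u' - u‖}

/-- The limiting (Mordukhovich) normal cone to `Ω` at `u`: the Painlevé-Kuratowski outer limit of
the regular normal cones at points `u' → u`. It is empty when `u ∉ Ω`. -/
def limitingNormalCone (Ω : Set E) (u : E) : Set E :=
  {p | u ∈ Ω ∧ ∃ x y : ℕ → E, Tendsto x atTop (𝓝 u) ∧ Tendsto y atTop (𝓝 p) ∧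
    ∀ k, y k ∈ regularNormalCone Ω (x k)}

end NormalCones

section Coderivative

variable {E F : Type*} [NormedAddCommGroup E] [InnerProductSpace ℝ E]
  [NormedAddCommGroup F] [InnerProductSpace ℝ F]

/-- The graph of a set-valued map, in the product space with the inner product
`⟪(u, v), (u', v')⟫ = ⟪u, u'⟫ + ⟪v, v'⟫`. -/
def setValuedGraph (Ψ : E → Set F) : Set (WithLp 2 (E × F)) :=
  {z | z.snd ∈ Ψ z.fst}

/-- The limiting coderivative `D*Ψ(u, v)(q) = {p | (p, -q) ∈ N_{gph Ψ}(u, v)}`. -/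
def limitingCoderivative (Ψ : E → Set F) (u : E) (v q : F) : Set E :=
  {p | WithLp.toLp 2 (p, -q) ∈ limitingNormalCone (setValuedGraph Ψ) (WithLp.toLp 2 (u, v))}

end Coderivative

section SecondOrderCone

variable {r : ℕ}

/-- The component of index `0` of a vector of `ℝ^{1+r}` (its components are `0, …, r`). -/
def headPart (y : EuclideanSpace ℝ (Fin (r + 1))) : ℝ := y 0

/-- The vector of the components of index `1, …, r`. -/
def tailPart (y : EuclideanSpace ℝ (Fin (r + 1))) : EuclideanSpace ℝ (Fin r) :=
  WithLp.toLp 2 (fun i => y i.succ)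

/-- The vector `(a; w)` of `ℝ^{1+r}`. -/
def consVec (a : ℝ) (w : EuclideanSpace ℝ (Fin r)) : EuclideanSpace ℝ (Fin (r + 1)) :=
  WithLp.toLp 2 (Fin.cons a (fun i => w i))

/-- `w / ‖w‖`, only used for `w ≠ 0`. -/
noncomputable def unitVec (w : EuclideanSpace ℝ (Fin r)) : EuclideanSpace ℝ (Fin r) :=
  ‖w‖⁻¹ • w

/-- The second-order cone in `ℝ^{1+r}`. -/
def secondOrderCone (r : ℕ) : Set (EuclideanSpace ℝ (Fin (r + 1))) :=
  {y | ‖tailPart y‖ ≤ headPart y}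

/-- `D*N_Q(u, v)(q)`, where `N_Q` is the normal cone map of the second-order cone `Q`. -/
def coderivNormalSOC (u v q : EuclideanSpace ℝ (Fin (r + 1))) :
    Set (EuclideanSpace ℝ (Fin (r + 1))) :=
  limitingCoderivative (fun z => limitingNormalCone (secondOrderCone r) z) u v q

end SecondOrderCone

/-! ### Regular normals: curves give necessary conditions, quadratic bounds sufficient ones. -/

section NormalConeCalculus

variable {E : Type*} [NormedAddCommGroup E] [InnerProductSpace ℝ E] {Ω : Set E}

/-! By self-duality of `Q`, the graph of its normal map is the set of pairs `(y, z)` with `y ∈ Q`,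
`-z ∈ Q`, `⟪y, z⟫ = 0`. For `y ≠ 0` it has two pieces: `y` interior with `z = 0`, and `y = a(1; w)`,
`z = -b(1; -w)` with `a > 0`, `b ≥ 0`, `‖w‖ = 1` (`interior_or_ray_of_mem_limitingNormalCone`).

Regular normals on each piece are found by testing against curves in the graph. Over the interior
the first component vanishes. For `a, b > 0`, varying `a` and `b` and rotating `w` yields the linear
equations `SmoothNormal`, which suffice because the remainder is quadratic. At `b = 0` the two
pieces meet, and the first component lies on the ray of normals to `Q` while the second satisfies a
half-space condition.

These conditions are closed in the normal and in `(a, b, w)`, so limits at `u ≠ 0` satisfy one of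
them (`regularNormalCone_normalGraph_cases`). Conversely, each claimed limiting normal is regular or
is reached along an explicit curve of base points.

The isometry `(y, z) ↦ (-z, -y)` preserves the graph, so `p ∈ D*N(u, v)(q)` iff `q ∈ D*N(-v,
-u)(p)`. This reduces the cases `u = 0`, `v ≠ 0` to `v = 0`, `u ≠ 0`, and pairs up the claims at the
vertex. -/

theorem regularNormalCone_subset_limitingNormalCone (Ω : Set E) (u : E) :
    regularNormalCone Ω u ⊆ limitingNormalCone Ω u := fun p hp =>
  ⟨hp.1, fun _ => u, fun _ => p, tendsto_const_nhds, tendsto_const_nhds, fun _ => hp⟩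

/-- Regular normals make a nonpositive inner product with the velocities of curves in the set. -/
theorem inner_nonpos_of_hasDerivAt {x p d : E} (hp : p ∈ regularNormalCone Ω x) {γ : ℝ → E}
    (hγ : HasDerivAt γ d 0) (h0 : γ 0 = x) (hΩ : ∀ᶠ t in 𝓝[>] 0, γ t ∈ Ω) :
    inner ℝ p d ≤ 0 := by
  have hs := (hasDerivWithinAt_iff_tendsto_slope' Set.self_notMem_Ioi).1
    (hγ.hasDerivWithinAt (s := Set.Ioi 0))
  have hc : Tendsto γ (𝓝[>] 0) (𝓝[Ω] x) :=
    tendsto_nhdsWithin_iff.2 ⟨h0 ▸ hγ.continuousAt.tendsto.mono_left nhdsWithin_le_nhds, hΩ⟩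
  -- Divide the defining inequality at `γ t` by `t > 0` and let `t → 0`; afterwards `ε → 0`.
  have key : ∀ ε : ℝ, 0 < ε → inner ℝ p d ≤ ε * ‖d‖ := by
    intro ε hε
    refine le_of_tendsto_of_tendsto ((tendsto_const_nhds (x := p)).inner hs)
      (hs.norm.const_mul ε) ?_
    filter_upwards [hc.eventually (hp.2 ε hε), self_mem_nhdsWithin] with t ht ht0
    have ht0 : 0 < t := ht0
    rw [slope_def_module, h0, sub_zero, inner_smul_right, norm_smul, norm_inv,
      Real.norm_of_nonneg ht0.le, mul_left_comm]
    gcongr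
  refine ge_of_tendsto (f := fun ε : ℝ => ε * ‖d‖) (x := 𝓝[>] 0) ?_
    (eventually_mem_nhdsWithin.mono key)
  have h : Continuous (fun ε : ℝ => ε * ‖d‖) := by fun_prop
  simpa using (h.tendsto 0).mono_left nhdsWithin_le_nhds

theorem inner_nonpos_of_eventually_add_smul_mem {x p d : E} (hp : p ∈ regularNormalCone Ω x)
    (hΩ : ∀ᶠ t : ℝ in 𝓝[>] 0, x + t • d ∈ Ω) : inner ℝ p d ≤ 0 := by
  refine inner_nonpos_of_hasDerivAt hp (γ := fun t : ℝ => x + t • d) ?_ (by simp) hΩ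
  simpa using ((hasDerivAt_id (0 : ℝ)).smul_const d).const_add x

/-- A quadratic bound is enough for a regular normal. -/
theorem mem_regularNormalCone_of_le_sq {x p : E} (hx : x ∈ Ω) (C : ℝ)
    (h : ∀ᶠ y in 𝓝[Ω] x, inner ℝ p (y - x) ≤ C * ‖y - x‖ ^ 2) : p ∈ regularNormalCone Ω x := by
  refine ⟨hx, fun ε hε => ?_⟩
  have hc : Tendsto (fun y => C * ‖y - x‖) (𝓝[Ω] x) (𝓝 0) := by
    have : Continuous (fun y => C * ‖y - x‖) := by fun_prop
    simpa using (this.tendsto x).mono_left nhdsWithin_le_nhds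
  filter_upwards [h, hc.eventually (gt_mem_nhds hε)] with y h1 h2
  nlinarith [norm_nonneg (y - x)]

end NormalConeCalculus

/-! ### The second-order cone: boundary, self-duality and normal cones. -/

section SecondOrderConeGeometry

variable {r : ℕ}

@[simp] theorem headPart_consVec (a : ℝ) (w : EuclideanSpace ℝ (Fin r)) :
    headPart (consVec a w) = a := rfl

@[simp] theorem tailPart_consVec (a : ℝ) (w : EuclideanSpace ℝ (Fin r)) :
    tailPart (consVec a w) = w := by
  ext i; simp [tailPart, consVec]

@[simp] theorem headPart_zero : headPart (0 : EuclideanSpace ℝ (Fin (r + 1))) = 0 := rfl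

@[simp] theorem tailPart_zero : tailPart (0 : EuclideanSpace ℝ (Fin (r + 1))) = 0 := rfl

@[simp] theorem headPart_add (x y : EuclideanSpace ℝ (Fin (r + 1))) :
    headPart (x + y) = headPart x + headPart y := rfl

@[simp] theorem tailPart_add (x y : EuclideanSpace ℝ (Fin (r + 1))) :
    tailPart (x + y) = tailPart x + tailPart y := rfl

@[simp] theorem headPart_sub (x y : EuclideanSpace ℝ (Fin (r + 1))) :
    headPart (x - y) = headPart x - headPart y := rfl

@[simp] theorem tailPart_sub (x y : EuclideanSpace ℝ (Fin (r + 1))) :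
    tailPart (x - y) = tailPart x - tailPart y := rfl

@[simp] theorem headPart_neg (x : EuclideanSpace ℝ (Fin (r + 1))) :
    headPart (-x) = -headPart x := rfl

@[simp] theorem tailPart_neg (x : EuclideanSpace ℝ (Fin (r + 1))) :
    tailPart (-x) = -tailPart x := rfl

@[simp] theorem headPart_smul (c : ℝ) (x : EuclideanSpace ℝ (Fin (r + 1))) :
    headPart (c • x) = c * headPart x := rfl

@[simp] theorem tailPart_smul (c : ℝ) (x : EuclideanSpace ℝ (Fin (r + 1))) :
    tailPart (c • x) = c • tailPart x := rfl

theorem ext_head_tail {x y : EuclideanSpace ℝ (Fin (r + 1))} (h : headPart x = headPart y)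
    (t : tailPart x = tailPart y) : x = y := by
  ext i
  refine Fin.cases h (fun j => ?_) i
  exact congrArg (fun z : EuclideanSpace ℝ (Fin r) => z j) t

theorem inner_eq_head_tail (x y : EuclideanSpace ℝ (Fin (r + 1))) :
    inner ℝ x y = headPart x * headPart y + inner ℝ (tailPart x) (tailPart y) := by
  simp [PiLp.inner_apply, Fin.sum_univ_succ, headPart, tailPart, mul_comm]

theorem norm_sq_eq_head_tail (x : EuclideanSpace ℝ (Fin (r + 1))) :
    ‖x‖ ^ 2 = headPart x ^ 2 + ‖tailPart x‖ ^ 2 := by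
  rw [← real_inner_self_eq_norm_sq, ← real_inner_self_eq_norm_sq, inner_eq_head_tail, sq]

theorem abs_headPart_le (x : EuclideanSpace ℝ (Fin (r + 1))) : |headPart x| ≤ ‖x‖ := by
  refine abs_le_of_sq_le_sq ?_ (norm_nonneg x)
  rw [norm_sq_eq_head_tail]
  nlinarith [sq_nonneg ‖tailPart x‖]

theorem norm_tailPart_le (x : EuclideanSpace ℝ (Fin (r + 1))) : ‖tailPart x‖ ≤ ‖x‖ := by
  refine le_of_sq_le_sq ?_ (norm_nonneg x)
  rw [norm_sq_eq_head_tail]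
  nlinarith [sq_nonneg (headPart x)]

@[fun_prop] theorem continuous_headPart :
    Continuous (headPart : EuclideanSpace ℝ (Fin (r + 1)) → ℝ) := by
  unfold headPart; fun_prop

@[fun_prop] theorem continuous_tailPart :
    Continuous (tailPart : EuclideanSpace ℝ (Fin (r + 1)) → EuclideanSpace ℝ (Fin r)) := by
  unfold tailPart; fun_prop

theorem continuous_consVec :
    Continuous (fun x : ℝ × EuclideanSpace ℝ (Fin r) => consVec x.1 x.2) := by
  unfold consVec
  refine (PiLp.continuous_toLp 2 _).comp (continuous_pi fun i => ?_)
  refine Fin.cases ?_ (fun j => ?_) i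
  · simpa using continuous_fst
  · simp only [Fin.cons_succ]; fun_prop

theorem isClosed_secondOrderCone : IsClosed (secondOrderCone r) :=
  isClosed_le (by fun_prop) (by fun_prop)

/-- A small step in the direction `-(1; 0)` stays in the cone from an interior point, and lowers the
head while keeping the tail. -/
theorem interior_secondOrderCone :
    interior (secondOrderCone r) = {y | ‖tailPart y‖ < headPart y} := by
  apply subset_antisymm
  · intro y hy
    have hQ : ‖tailPart y‖ ≤ headPart y := interior_subset (s := secondOrderCone r) hy
    have hc : Tendsto (fun t : ℝ => y - t • consVec 1 0) (𝓝[>] 0) (𝓝 y) := by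
      have h : Continuous (fun t : ℝ => y - t • (consVec 1 0 : EuclideanSpace ℝ (Fin (r + 1)))) := by
        fun_prop
      simpa using (h.tendsto 0).mono_left nhdsWithin_le_nhds
    obtain ⟨t, ht, ht0⟩ := ((hc.eventually (mem_interior_iff_mem_nhds.1 hy)).and
      self_mem_nhdsWithin).exists
    have ht' : ‖tailPart (y - t • consVec 1 0)‖ ≤ headPart (y - t • consVec 1 0) := ht
    have ht0 : 0 < t := ht0
    simp at ht'
    show ‖tailPart y‖ < headPart y
    linarith
  · exact interior_maximal (fun y (hy : ‖tailPart y‖ < headPart y) => hy.le)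
      (isOpen_lt (by fun_prop) (by fun_prop))

theorem frontier_secondOrderCone :
    frontier (secondOrderCone r) = {y | ‖tailPart y‖ = headPart y} := by
  rw [isClosed_secondOrderCone.frontier_eq, interior_secondOrderCone]
  ext y
  simp only [Set.mem_sdiff, Set.mem_ofPred_eq, secondOrderCone, not_lt]
  exact ⟨fun h => le_antisymm h.1 h.2, fun h => ⟨h.le, h.ge⟩⟩

theorem inner_nonneg_of_mem_secondOrderCone {x y : EuclideanSpace ℝ (Fin (r + 1))}
    (hx : x ∈ secondOrderCone r) (hy : y ∈ secondOrderCone r) : 0 ≤ inner ℝ x y := by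
  have hx' : ‖tailPart x‖ ≤ headPart x := hx
  have hy' : ‖tailPart y‖ ≤ headPart y := hy
  rw [inner_eq_head_tail]
  have h := abs_le.1 (abs_real_inner_le_norm (tailPart x) (tailPart y))
  have := mul_le_mul hx' hy' (norm_nonneg _) ((norm_nonneg _).trans hx')
  linarith [h.1]

/-- The nontrivial test vector is `(‖p̄‖; -p̄)`, which pairs with `p` to `‖p̄‖(ṗ - ‖p̄‖)`; for `p̄ =
0` the axis `(1; 0)` serves. Together with `inner_nonneg_of_mem_secondOrderCone` this is
self-duality. -/
theorem mem_secondOrderCone_of_inner_nonneg {p : EuclideanSpace ℝ (Fin (r + 1))}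
    (h : ∀ y ∈ secondOrderCone r, 0 ≤ inner ℝ p y) : p ∈ secondOrderCone r := by
  show ‖tailPart p‖ ≤ headPart p
  rcases (norm_nonneg (tailPart p)).eq_or_lt with h0 | h0
  · have := h (consVec 1 0) (by simp [secondOrderCone])
    rw [inner_eq_head_tail] at this
    simpa [← h0] using this
  · have := h (consVec ‖tailPart p‖ (-tailPart p)) (by simp [secondOrderCone])
    rw [inner_eq_head_tail] at this
    simp only [headPart_consVec, tailPart_consVec, inner_neg_right,
      real_inner_self_eq_norm_sq] at this
    nlinarith

theorem smul_mem_secondOrderCone {c : ℝ} (hc : 0 ≤ c) {y : EuclideanSpace ℝ (Fin (r + 1))}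
    (hy : y ∈ secondOrderCone r) : c • y ∈ secondOrderCone r := by
  have hy' : ‖tailPart y‖ ≤ headPart y := hy
  show ‖tailPart (c • y)‖ ≤ headPart (c • y)
  rw [tailPart_smul, norm_smul, headPart_smul, Real.norm_of_nonneg hc]
  exact mul_le_mul_of_nonneg_left hy' hc

theorem add_mem_secondOrderCone {x y : EuclideanSpace ℝ (Fin (r + 1))}
    (hx : x ∈ secondOrderCone r) (hy : y ∈ secondOrderCone r) : x + y ∈ secondOrderCone r :=
  (norm_add_le _ _).trans (add_le_add hx hy)

theorem consVec_mem_secondOrderCone {w : EuclideanSpace ℝ (Fin r)} (hw : ‖w‖ = 1) :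
    consVec 1 w ∈ secondOrderCone r := by
  simp [secondOrderCone, hw]

theorem norm_unitVec {w : EuclideanSpace ℝ (Fin r)} (hw : w ≠ 0) : ‖unitVec w‖ = 1 := by
  simp [unitVec, norm_smul, hw]

theorem unitVec_neg (w : EuclideanSpace ℝ (Fin r)) : unitVec (-w) = -unitVec w := by
  simp [unitVec]

theorem unitVec_smul {a : ℝ} (ha : 0 < a) {w : EuclideanSpace ℝ (Fin r)} (hw : ‖w‖ = 1) :
    unitVec (a • w) = w := by
  simp [unitVec, norm_smul, hw, abs_of_pos ha, smul_smul, ha.ne']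

theorem continuousAt_unitVec {w : EuclideanSpace ℝ (Fin r)} (hw : w ≠ 0) :
    ContinuousAt unitVec w := by
  unfold unitVec
  exact (continuousAt_id.norm.inv₀ (by simpa using hw)).smul continuousAt_id

theorem exists_eq_smul_of_mem_frontier {u : EuclideanSpace ℝ (Fin (r + 1))}
    (hu : u ∈ frontier (secondOrderCone r) \ {0}) :
    ∃ (a : ℝ) (w : EuclideanSpace ℝ (Fin r)), 0 < a ∧ ‖w‖ = 1 ∧ u = a • consVec 1 w := by
  rw [frontier_secondOrderCone] at hu
  obtain ⟨h, h0⟩ := hu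
  have h : ‖tailPart u‖ = headPart u := h
  have ht : tailPart u ≠ 0 := fun e => h0 (ext_head_tail (by rw [← h, e]; simp) (by simp [e]))
  refine ⟨‖tailPart u‖, unitVec (tailPart u), by simpa using ht, norm_unitVec ht,
    ext_head_tail (by simp [h]) ?_⟩
  simp [unitVec, smul_smul, ht]

/-- The regular normal cone of the second-order cone. -/
theorem mem_regularNormalCone_secondOrderCone {u p : EuclideanSpace ℝ (Fin (r + 1))} :
    p ∈ regularNormalCone (secondOrderCone r) u ↔
      u ∈ secondOrderCone r ∧ -p ∈ secondOrderCone r ∧ inner ℝ u p = 0 := by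
  constructor
  · rintro ⟨hu, h⟩
    have key : ∀ d, (∀ᶠ t : ℝ in 𝓝[>] 0, u + t • d ∈ secondOrderCone r) → inner ℝ p d ≤ 0 :=
      fun d hd => inner_nonpos_of_eventually_add_smul_mem ⟨hu, h⟩ hd
    refine ⟨hu, mem_secondOrderCone_of_inner_nonneg fun y hy => ?_, le_antisymm ?_ ?_⟩
    · have := key y (eventually_mem_nhdsWithin.mono fun t (ht : 0 < t) =>
        add_mem_secondOrderCone hu (smul_mem_secondOrderCone ht.le hy))
      rw [inner_neg_left]; linarith
    · rw [real_inner_comm]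
      exact key u (eventually_mem_nhdsWithin.mono fun t (ht : 0 < t) =>
        add_mem_secondOrderCone hu (smul_mem_secondOrderCone ht.le hu))
    · have := key (-u) (by
        filter_upwards [Ioo_mem_nhdsGT (zero_lt_one' ℝ)] with t ht
        have : u + t • -u = (1 - t) • u := by module
        rw [this]
        exact smul_mem_secondOrderCone (by linarith [ht.2]) hu)
      rw [inner_neg_right, real_inner_comm] at this
      linarith
  · rintro ⟨hu, hp, h⟩
    refine ⟨hu, fun ε hε => ?_⟩
    filter_upwards [self_mem_nhdsWithin] with y hy
    have := inner_nonneg_of_mem_secondOrderCone hp hy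
    rw [inner_neg_left] at this
    rw [inner_sub_right, real_inner_comm u p, h]
    have : 0 ≤ ε * ‖y - u‖ := by positivity
    linarith

/-- The limiting normal cone of the second-order cone. -/
theorem mem_limitingNormalCone_secondOrderCone {u p : EuclideanSpace ℝ (Fin (r + 1))} :
    p ∈ limitingNormalCone (secondOrderCone r) u ↔
      u ∈ secondOrderCone r ∧ -p ∈ secondOrderCone r ∧ inner ℝ u p = 0 := by
  constructor
  · rintro ⟨hu, x, y, hx, hy, h⟩
    simp only [mem_regularNormalCone_secondOrderCone] at h
    refine ⟨hu, isClosed_secondOrderCone.mem_of_tendsto hy.neg (.of_forall fun k => (h k).2.1),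
      tendsto_nhds_unique (hx.inner hy) ?_⟩
    simp [fun k => (h k).2.2]
  · intro h
    exact regularNormalCone_subset_limitingNormalCone _ _
      (mem_regularNormalCone_secondOrderCone.2 h)

/-- The points of the graph of the normal cone map away from the vertex. -/
theorem interior_or_ray_of_mem_limitingNormalCone {y z : EuclideanSpace ℝ (Fin (r + 1))}
    (h : z ∈ limitingNormalCone (secondOrderCone r) y) (hy0 : y ≠ 0) :
    (y ∈ interior (secondOrderCone r) ∧ z = 0) ∨
      ∃ (a b : ℝ) (w : EuclideanSpace ℝ (Fin r)), 0 < a ∧ 0 ≤ b ∧ ‖w‖ = 1 ∧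
        y = a • consVec 1 w ∧ z = -(b • consVec 1 (-w)) := by
  obtain ⟨hy, hz, hi⟩ := mem_limitingNormalCone_secondOrderCone.1 h
  have hz' : ‖tailPart z‖ ≤ -headPart z := by simpa [secondOrderCone] using hz
  have hy' : ‖tailPart y‖ ≤ headPart y := hy
  rw [inner_eq_head_tail] at hi
  rcases hy'.lt_or_eq with hlt | heq
  · left
    refine ⟨by rw [interior_secondOrderCone]; exact hlt, ?_⟩
    have h1 := (abs_le.1 (abs_real_inner_le_norm (tailPart y) (tailPart z))).2
    -- Orthogonality and Cauchy-Schwarz give `ẏ(-ż) ≤ ‖ȳ‖(-ż)`, impossible for `ż < 0` since `‖ȳ‖ <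
    -- ẏ`.
    have h2 : headPart z = 0 := by
      have h3 : headPart z ≤ 0 := by linarith [norm_nonneg (tailPart z)]
      by_contra hne
      have h4 : headPart z < 0 := lt_of_le_of_ne h3 hne
      have h5 := mul_le_mul_of_nonneg_left hz' (norm_nonneg (tailPart y))
      nlinarith
    refine ext_head_tail h2 ?_
    rw [h2] at hz'
    simpa using hz'
  · right
    obtain ⟨a, w, ha, hw, rfl⟩ := exists_eq_smul_of_mem_frontier (u := y)
      ⟨by rw [frontier_secondOrderCone]; exact heq, hy0⟩
    refine ⟨a, -headPart z, w, ha, by linarith [norm_nonneg (tailPart z)], hw, rfl,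
      ext_head_tail (by simp) ?_⟩
    simp only [headPart_smul, headPart_consVec, mul_one, tailPart_smul, tailPart_consVec,
      inner_smul_left, conj_trivial, ← mul_add, mul_eq_zero, ha.ne', false_or] at hi
    -- The equality case of Cauchy-Schwarz: `⟪w, z̄⟫ = -ż` and `‖z̄‖ ≤ -ż` force `z̄ = -ż w`.
    have h1 : ‖tailPart z - (-headPart z) • w‖ ^ 2 ≤ 0 := by
      rw [norm_sub_sq_real, inner_smul_right, norm_smul, hw, real_inner_comm, mul_one,
        Real.norm_eq_abs, sq_abs]
      nlinarith [norm_nonneg (tailPart z)]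
    have h2 : tailPart z - (-headPart z) • w = 0 := by
      rw [← norm_eq_zero]; exact pow_eq_zero_iff (two_ne_zero) |>.1 (le_antisymm h1 (sq_nonneg _))
    rw [sub_eq_zero.1 h2]
    simp

theorem smul_consVec_neg_mem_limitingNormalCone {a b : ℝ} (ha : 0 ≤ a) (hb : 0 ≤ b)
    {w : EuclideanSpace ℝ (Fin r)} (hw : ‖w‖ = 1) :
    -(b • consVec 1 (-w)) ∈ limitingNormalCone (secondOrderCone r) (a • consVec 1 w) := by
  refine mem_limitingNormalCone_secondOrderCone.2
    ⟨smul_mem_secondOrderCone ha (consVec_mem_secondOrderCone hw), ?_, ?_⟩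
  · rw [neg_neg]
    exact smul_mem_secondOrderCone hb (consVec_mem_secondOrderCone (by simpa using hw))
  · simp [inner_eq_head_tail, inner_smul_left, inner_smul_right, hw]

end SecondOrderConeGeometry

/-! ### The graph of the normal map: symmetry and necessary conditions on regular normals. -/

section NormalGraph

variable {r : ℕ}

/-- The graph of the normal cone map of the second-order cone. -/
abbrev normalGraph (r : ℕ) :
    Set (WithLp 2 (EuclideanSpace ℝ (Fin (r + 1)) × EuclideanSpace ℝ (Fin (r + 1)))) :=
  setValuedGraph (fun z : EuclideanSpace ℝ (Fin (r + 1)) =>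
    limitingNormalCone (secondOrderCone r) z)

theorem mem_normalGraph_of_eq {y z : EuclideanSpace ℝ (Fin (r + 1))}
    (h : z ∈ limitingNormalCone (secondOrderCone r) y)
    {x : WithLp 2 (EuclideanSpace ℝ (Fin (r + 1)) × EuclideanSpace ℝ (Fin (r + 1)))}
    (hy : x.fst = y) (hz : x.snd = z) : x ∈ normalGraph r := by
  subst hy hz; exact h

/-- The isometry `(y, z) ↦ (-z, -y)`, which preserves `normalGraph`. -/
def negSwap {E : Type*} [AddGroup E] (x : WithLp 2 (E × E)) : WithLp 2 (E × E) :=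
  WithLp.toLp 2 (-x.snd, -x.fst)

theorem negSwap_negSwap {E : Type*} [AddGroup E] (x : WithLp 2 (E × E)) :
    negSwap (negSwap x) = x := by
  obtain ⟨x₁, x₂⟩ := x
  simp [negSwap]

theorem continuous_negSwap {E : Type*} [NormedAddCommGroup E] [InnerProductSpace ℝ E] :
    Continuous (negSwap : WithLp 2 (E × E) → WithLp 2 (E × E)) := by
  unfold negSwap; fun_prop

/-- `negSwap` is a self-adjoint isometric involution, so it moves across the inner product and
leaves distances unchanged. -/
theorem negSwap_mem_regularNormalCone {E : Type*} [NormedAddCommGroup E] [InnerProductSpace ℝ E]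
    {Ω : Set (WithLp 2 (E × E))} (hΩ : ∀ x ∈ Ω, negSwap x ∈ Ω) {x p : WithLp 2 (E × E)}
    (hp : p ∈ regularNormalCone Ω x) : negSwap p ∈ regularNormalCone Ω (negSwap x) := by
  refine ⟨hΩ _ hp.1, fun ε hε => ?_⟩
  have hc : Tendsto negSwap (𝓝[Ω] (negSwap x)) (𝓝[Ω] x) := by
    refine tendsto_nhdsWithin_iff.2 ⟨?_, eventually_mem_nhdsWithin.mono fun y hy => hΩ y hy⟩
    simpa only [negSwap_negSwap] using
      ((continuous_negSwap (E := E)).tendsto (negSwap x)).mono_left nhdsWithin_le_nhds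
  filter_upwards [hc.eventually (hp.2 ε hε)] with y hy
  have h1 : inner ℝ p (negSwap y - x) = inner ℝ (negSwap p) (y - negSwap x) := by
    obtain ⟨p₁, p₂⟩ := p
    obtain ⟨x₁, x₂⟩ := x
    obtain ⟨y₁, y₂⟩ := y
    simp [WithLp.prod_inner_apply, negSwap, ← WithLp.toLp_sub, inner_sub_right, inner_add_right]
    ring
  have h2 : ‖negSwap y - x‖ = ‖y - negSwap x‖ := by
    rw [← sq_eq_sq₀ (norm_nonneg _) (norm_nonneg _), WithLp.prod_norm_sq_eq_of_L2,
      WithLp.prod_norm_sq_eq_of_L2, add_comm]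
    have h (a b : E) : ‖-a - b‖ = ‖a + b‖ := by rw [← norm_neg, neg_sub', neg_neg, sub_neg_eq_add]
    simp [negSwap, h]
  rwa [h1, h2] at hy

theorem negSwap_mem_limitingNormalCone {E : Type*} [NormedAddCommGroup E] [InnerProductSpace ℝ E]
    {Ω : Set (WithLp 2 (E × E))} (hΩ : ∀ x ∈ Ω, negSwap x ∈ Ω) {x p : WithLp 2 (E × E)}
    (hp : p ∈ limitingNormalCone Ω x) : negSwap p ∈ limitingNormalCone Ω (negSwap x) := by
  obtain ⟨hx, y, z, hy, hz, h⟩ := hp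
  exact ⟨hΩ _ hx, fun k => negSwap (y k), fun k => negSwap (z k),
    (continuous_negSwap.tendsto _).comp hy, (continuous_negSwap.tendsto _).comp hz,
    fun k => negSwap_mem_regularNormalCone hΩ (h k)⟩

theorem negSwap_mem_normalGraph :
    ∀ x ∈ normalGraph r, negSwap x ∈ normalGraph r := by
  intro x hx
  obtain ⟨h1, h2, h3⟩ := mem_limitingNormalCone_secondOrderCone.1 hx
  refine mem_limitingNormalCone_secondOrderCone.2 ⟨h2, ?_, ?_⟩
  · simpa [negSwap] using h1
  · simpa [negSwap, real_inner_comm] using h3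

theorem mem_coderivNormalSOC_swap {u v p q : EuclideanSpace ℝ (Fin (r + 1))}
    (h : p ∈ coderivNormalSOC u v q) : q ∈ coderivNormalSOC (-v) (-u) p := by
  have := negSwap_mem_limitingNormalCone negSwap_mem_normalGraph h
  simpa [negSwap, coderivNormalSOC, limitingCoderivative] using this

theorem mem_coderivNormalSOC_swap_iff {u v p q : EuclideanSpace ℝ (Fin (r + 1))} :
    p ∈ coderivNormalSOC u v q ↔ q ∈ coderivNormalSOC (-v) (-u) p :=
  ⟨mem_coderivNormalSOC_swap, fun h => by simpa using mem_coderivNormalSOC_swap h⟩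

theorem eq_zero_of_mem_limitingNormalCone_of_mem_interior
    {y z : EuclideanSpace ℝ (Fin (r + 1))} (hy : y ∈ interior (secondOrderCone r))
    (h : z ∈ limitingNormalCone (secondOrderCone r) y) : z = 0 := by
  have hy' := hy
  rw [interior_secondOrderCone] at hy'
  have hy' : ‖tailPart y‖ < headPart y := hy'
  rcases interior_or_ray_of_mem_limitingNormalCone h (by rintro rfl; simp at hy') with h | h
  · exact h.2
  · obtain ⟨a, b, w, ha, hb, hw, rfl, rfl⟩ := h
    simp [norm_smul, hw, abs_of_pos ha] at hy'

theorem zero_mem_limitingNormalCone_secondOrderCone {y : EuclideanSpace ℝ (Fin (r + 1))}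
    (hy : y ∈ secondOrderCone r) : 0 ∈ limitingNormalCone (secondOrderCone r) y :=
  mem_limitingNormalCone_secondOrderCone.2 ⟨hy, by simp [secondOrderCone], by simp⟩

/-- Over the interior, `p` itself is an admissible velocity of the first component, whence `‖p‖² ≤
0`. -/
theorem fst_eq_zero_of_mem_regularNormalCone {y z p s : EuclideanSpace ℝ (Fin (r + 1))}
    (hy : y ∈ interior (secondOrderCone r))
    (h : WithLp.toLp 2 (p, s) ∈ regularNormalCone (normalGraph r) (WithLp.toLp 2 (y, z))) :
    p = 0 := by
  obtain rfl : z = 0 := eq_zero_of_mem_limitingNormalCone_of_mem_interior hy h.1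
  have hc : Tendsto (fun t : ℝ => y + t • p) (𝓝[>] 0) (𝓝 y) := by
    have h : Continuous (fun t : ℝ => y + t • p) := by fun_prop
    simpa using (h.tendsto 0).mono_left nhdsWithin_le_nhds
  have := inner_nonpos_of_eventually_add_smul_mem h (d := WithLp.toLp 2 (p, 0)) (by
    filter_upwards [hc.eventually (mem_interior_iff_mem_nhds.1 hy)] with t ht
    simpa [setValuedGraph] using zero_mem_limitingNormalCone_secondOrderCone ht)
  simpa [WithLp.prod_inner_apply] using this

/-- The graph contains `Q × {0}`, and testing only there leaves the normality condition for `Q`. -/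
theorem fst_mem_regularNormalCone {y p s : EuclideanSpace ℝ (Fin (r + 1))}
    (h : WithLp.toLp 2 (p, s) ∈ regularNormalCone (normalGraph r) (WithLp.toLp 2 (y, 0))) :
    p ∈ regularNormalCone (secondOrderCone r) y := by
  have hy : y ∈ secondOrderCone r := (mem_limitingNormalCone_secondOrderCone.1 h.1).1
  refine ⟨hy, fun ε hε => ?_⟩
  have hc : Tendsto (fun y' : EuclideanSpace ℝ (Fin (r + 1)) =>
      WithLp.toLp 2 (y', (0 : EuclideanSpace ℝ (Fin (r + 1)))))
      (𝓝[secondOrderCone r] y) (𝓝[normalGraph r] (WithLp.toLp 2 (y, 0))) := by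
    refine tendsto_nhdsWithin_iff.2 ⟨?_, eventually_mem_nhdsWithin.mono fun y' hy' =>
      zero_mem_limitingNormalCone_secondOrderCone hy'⟩
    refine Tendsto.mono_left (Continuous.tendsto ?_ y) nhdsWithin_le_nhds
    fun_prop
  filter_upwards [hc.eventually (h.2 ε hε)] with y' hy'
  rw [← WithLp.toLp_sub] at hy'
  simpa [WithLp.prod_inner_apply, WithLp.prod_norm_eq_of_L2] using hy'

theorem inner_snd_nonneg_of_mem_regularNormalCone {p s : EuclideanSpace ℝ (Fin (r + 1))}
    {a : ℝ} {w : EuclideanSpace ℝ (Fin r)} (ha : 0 ≤ a) (hw : ‖w‖ = 1)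
    (h : WithLp.toLp 2 (p, s) ∈ regularNormalCone (normalGraph r)
      (WithLp.toLp 2 (a • consVec 1 w, 0))) : 0 ≤ inner ℝ s (consVec 1 (-w)) := by
  have := inner_nonpos_of_eventually_add_smul_mem h
    (d := WithLp.toLp 2 (0, -consVec 1 (-w))) (by
    filter_upwards [self_mem_nhdsWithin] with t ht
    simpa [setValuedGraph] using smul_consVec_neg_mem_limitingNormalCone ha (le_of_lt ht) hw)
  simpa [WithLp.prod_inner_apply] using this

/-- The equations for the normals to `normalGraph` at `(a (1; w), -b (1; -w))`. -/
def SmoothNormal (a b : ℝ) (w : EuclideanSpace ℝ (Fin r))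
    (p s : EuclideanSpace ℝ (Fin (r + 1))) : Prop :=
  inner ℝ p (consVec 1 w) = 0 ∧ inner ℝ s (consVec 1 (-w)) = 0 ∧
    a • tailPart p + b • tailPart s = inner ℝ (a • tailPart p + b • tailPart s) w • w

theorem smoothNormal_of_mem_regularNormalCone {p s : EuclideanSpace ℝ (Fin (r + 1))}
    {a b : ℝ} {w : EuclideanSpace ℝ (Fin r)} (ha : 0 < a) (hb : 0 < b) (hw : ‖w‖ = 1)
    (h : WithLp.toLp 2 (p, s) ∈ regularNormalCone (normalGraph r)
      (WithLp.toLp 2 (a • consVec 1 w, -(b • consVec 1 (-w))))) : SmoothNormal a b w p s := by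
  -- As `a, b > 0`, both can move in either direction with `w` fixed; the free signs of `c`, `d`
  -- turn the inequality into two equations.
  have line : ∀ c d : ℝ, c * inner ℝ p (consVec 1 w) - d * inner ℝ s (consVec 1 (-w)) ≤ 0 := by
    intro c d
    have hca : Tendsto (fun t : ℝ => a + t * c) (𝓝[>] 0) (𝓝 a) := by
      have h : Continuous (fun t : ℝ => a + t * c) := by fun_prop
      simpa using (h.tendsto 0).mono_left nhdsWithin_le_nhds
    have hcb : Tendsto (fun t : ℝ => b + t * d) (𝓝[>] 0) (𝓝 b) := by
      have h : Continuous (fun t : ℝ => b + t * d) := by fun_prop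
      simpa using (h.tendsto 0).mono_left nhdsWithin_le_nhds
    have := inner_nonpos_of_eventually_add_smul_mem h
      (d := WithLp.toLp 2 (c • consVec 1 w, -(d • consVec 1 (-w)))) (by
      filter_upwards [hca.eventually (lt_mem_nhds ha), hcb.eventually (lt_mem_nhds hb)]
        with t h1 h2
      have := smul_consVec_neg_mem_limitingNormalCone h1.le h2.le hw
      refine mem_normalGraph_of_eq this ?_ ?_
      · simp only [WithLp.add_fst, WithLp.smul_fst, WithLp.toLp_fst]; module
      · simp only [WithLp.add_snd, WithLp.smul_snd, WithLp.toLp_snd]; module)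
    simpa [WithLp.prod_inner_apply, inner_smul_right, sub_eq_add_neg] using this
  -- Keep `a`, `b` and rotate `w` along `cos t w + sin t ξ`; the velocity at `t = 0` is `((0; aξ),
  -- (0; bξ))`.
  have rot : ∀ ξ : EuclideanSpace ℝ (Fin r), ‖ξ‖ = 1 → inner ℝ w ξ = 0 →
      inner ℝ (a • tailPart p + b • tailPart s) ξ ≤ 0 := by
    intro ξ hξ hwξ
    have hd := (((Real.hasDerivAt_cos 0).smul_const (WithLp.toLp 2
        (a • consVec 0 w, b • consVec 0 w))).fun_add ((Real.hasDerivAt_sin 0).smul_const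
        (WithLp.toLp 2 (a • consVec 0 ξ, b • consVec 0 ξ)))).const_add
        (WithLp.toLp 2 (a • (consVec 1 0 : EuclideanSpace ℝ (Fin (r + 1))), -(b • consVec 1 0)))
    have := inner_nonpos_of_hasDerivAt h hd (by
      simp only [Real.cos_zero, Real.sin_zero, one_smul, zero_smul, add_zero]
      rw [← WithLp.toLp_add]
      congr 1
      refine Prod.ext ?_ ?_ <;> refine ext_head_tail ?_ ?_ <;> simp) (.of_forall fun t => by
      have hn : ‖Real.cos t • w + Real.sin t • ξ‖ = 1 := by
        rw [← sq_eq_sq₀ (norm_nonneg _) zero_le_one, norm_add_sq_real, inner_smul_left,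
          inner_smul_right, hwξ, norm_smul, norm_smul, hw, hξ]
        simp
      have := smul_consVec_neg_mem_limitingNormalCone ha.le hb.le hn
      refine mem_normalGraph_of_eq this ?_ ?_ <;> refine ext_head_tail ?_ ?_ <;>
        simp only [WithLp.add_fst, WithLp.smul_fst, WithLp.toLp_fst, WithLp.add_snd,
          WithLp.smul_snd, WithLp.toLp_snd, headPart_add, headPart_smul, headPart_neg,
          headPart_consVec, tailPart_add, tailPart_smul, tailPart_neg, tailPart_consVec]
      · ring
      · module
      · ring
      · module)
    simpa [WithLp.prod_inner_apply, inner_add_left, inner_smul_left, inner_smul_right,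
      inner_eq_head_tail] using this
  refine ⟨?_, ?_, ?_⟩
  · linarith [line 1 0, line (-1) 0]
  · linarith [line 0 1, line 0 (-1)]
  · set m := a • tailPart p + b • tailPart s with hm
    by_contra hne
    have hx0 : m - inner ℝ m w • w ≠ 0 := sub_ne_zero.2 hne
    have horth : inner ℝ w (m - inner ℝ m w • w) = 0 := by
      rw [inner_sub_right, inner_smul_right, real_inner_self_eq_norm_sq, hw, real_inner_comm]
      ring
    -- Rotating towards the component of `m` orthogonal to `w` would give it a nonpositive norm.
    have h1 := rot (unitVec (m - inner ℝ m w • w)) (norm_unitVec hx0) (by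
      rw [unitVec, inner_smul_right, horth, mul_zero])
    have h2 : inner ℝ m (m - inner ℝ m w • w) = ‖m - inner ℝ m w • w‖ ^ 2 := by
      rw [← real_inner_self_eq_norm_sq]
      conv_rhs => rw [inner_sub_left, inner_smul_left, horth]
      simp
    rw [unitVec, inner_smul_right, h2] at h1
    have h3 : 0 < ‖m - inner ℝ m w • w‖ := norm_pos_iff.2 hx0
    have h4 : 0 < ‖m - inner ℝ m w • w‖⁻¹ * ‖m - inner ℝ m w • w‖ ^ 2 := by positivity
    linarith

end NormalGraph

/-! ### Sufficient conditions for regular normals, by quadratic estimates. -/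

section NormalGraphSufficient

variable {r : ℕ}

theorem mem_regularNormalCone_of_mem_interior {y : EuclideanSpace ℝ (Fin (r + 1))}
    (hy : y ∈ interior (secondOrderCone r)) (s : EuclideanSpace ℝ (Fin (r + 1))) :
    WithLp.toLp 2 (0, s) ∈ regularNormalCone (normalGraph r) (WithLp.toLp 2 (y, 0)) := by
  refine mem_regularNormalCone_of_le_sq
    (zero_mem_limitingNormalCone_secondOrderCone (interior_subset hy)) 0 ?_
  have hc : Tendsto (fun x : WithLp 2 (EuclideanSpace ℝ (Fin (r + 1)) ×
      EuclideanSpace ℝ (Fin (r + 1))) => x.fst) (𝓝[normalGraph r] (WithLp.toLp 2 (y, 0)))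
      (𝓝 y) :=
    Tendsto.mono_left (Continuous.tendsto (by fun_prop) (WithLp.toLp 2 (y, 0)))
      nhdsWithin_le_nhds
  filter_upwards [hc.eventually (isOpen_interior.mem_nhds hy), self_mem_nhdsWithin] with x h1 h2
  have : x.snd = 0 := eq_zero_of_mem_limitingNormalCone_of_mem_interior h1 h2
  obtain ⟨x₁, x₂⟩ := x
  have : x₂ = 0 := this
  simp [WithLp.prod_inner_apply, ← WithLp.toLp_sub, this]

theorem norm_le_norm_toLp_left {E F : Type*} [NormedAddCommGroup E] [NormedAddCommGroup F]
    (x : E) (y : F) : ‖x‖ ≤ ‖WithLp.toLp 2 (x, y)‖ :=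
  WithLp.norm_fst_le E (WithLp.toLp 2 (x, y))

theorem norm_le_norm_toLp_right {E F : Type*} [NormedAddCommGroup E] [NormedAddCommGroup F]
    (x : E) (y : F) : ‖y‖ ≤ ‖WithLp.toLp 2 (x, y)‖ :=
  WithLp.norm_snd_le E (WithLp.toLp 2 (x, y))

/-- The direction of a boundary ray depends on its points in a Lipschitz way. -/
theorem norm_sub_le_of_smul_consVec {a a' : ℝ} (ha : 0 < a) {w w' : EuclideanSpace ℝ (Fin r)}
    (hw' : ‖w'‖ = 1) : ‖w' - w‖ ≤ 2 / a * ‖a' • consVec 1 w' - a • consVec 1 w‖ := by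
  have h1 := abs_headPart_le (a' • consVec 1 w' - a • consVec 1 w)
  have h2 := norm_tailPart_le (a' • consVec 1 w' - a • consVec 1 w)
  simp only [headPart_sub, headPart_smul, headPart_consVec, mul_one, tailPart_sub, tailPart_smul,
    tailPart_consVec] at h1 h2
  have h3 : a * ‖w' - w‖ ≤ ‖a' • w' - a • w‖ + |a' - a| := by
    -- The two terms are controlled by the tail and the head of the displacement, hence the factor
    -- 2.
    have : a • (w' - w) = (a' • w' - a • w) - (a' - a) • w' := by module
    rw [← Real.norm_of_nonneg ha.le, ← norm_smul, Real.norm_of_nonneg ha.le, this]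
    refine (norm_sub_le _ _).trans ?_
    rw [norm_smul (a' - a), hw', mul_one, Real.norm_eq_abs]
  rw [div_mul_eq_mul_div, le_div_iff₀ ha]
  linarith

theorem eventually_fst_ne_zero {y z : EuclideanSpace ℝ (Fin (r + 1))} (hy : y ≠ 0) :
    ∀ᶠ x in 𝓝[normalGraph r] (WithLp.toLp 2 (y, z)), x.fst ≠ 0 := by
  have hc : Tendsto (fun x : WithLp 2 (EuclideanSpace ℝ (Fin (r + 1)) ×
      EuclideanSpace ℝ (Fin (r + 1))) => x.fst) (𝓝[normalGraph r] (WithLp.toLp 2 (y, z)))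
      (𝓝 y) :=
    Tendsto.mono_left (Continuous.tendsto (by fun_prop) (WithLp.toLp 2 (y, z)))
      nhdsWithin_le_nhds
  exact hc.eventually_ne hy

theorem eventually_snd_ne_zero {y z : EuclideanSpace ℝ (Fin (r + 1))} (hz : z ≠ 0) :
    ∀ᶠ x in 𝓝[normalGraph r] (WithLp.toLp 2 (y, z)), x.snd ≠ 0 := by
  have hc : Tendsto (fun x : WithLp 2 (EuclideanSpace ℝ (Fin (r + 1)) ×
      EuclideanSpace ℝ (Fin (r + 1))) => x.snd) (𝓝[normalGraph r] (WithLp.toLp 2 (y, z)))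
      (𝓝 z) :=
    Tendsto.mono_left (Continuous.tendsto (by fun_prop) (WithLp.toLp 2 (y, z)))
      nhdsWithin_le_nhds
  exact hc.eventually_ne hz

theorem smul_consVec_one_ne_zero {a : ℝ} (ha : a ≠ 0) (w : EuclideanSpace ℝ (Fin r)) :
    a • consVec 1 w ≠ 0 := fun h => by
  have := congrArg headPart h
  simp at this
  exact ha this

/-- The equations cancel the terms linear in `a' - a` and `b' - b`. The term in `w' - w` is `κ⟪w, w'
- w⟫ = -κ‖w' - w‖²/2`, as both vectors are unit; what remains is a product of `w' - w` with `a' - a`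
or `b' - b`. All of it is quadratic in the displacement. -/
theorem mem_regularNormalCone_of_smoothNormal {p s : EuclideanSpace ℝ (Fin (r + 1))}
    {a b : ℝ} {w : EuclideanSpace ℝ (Fin r)} (ha : 0 < a) (hb : 0 < b) (hw : ‖w‖ = 1)
    (h : SmoothNormal a b w p s) :
    WithLp.toLp 2 (p, s) ∈ regularNormalCone (normalGraph r)
      (WithLp.toLp 2 (a • consVec 1 w, -(b • consVec 1 (-w)))) := by
  obtain ⟨hp, hs, hk⟩ := h
  set κ := inner ℝ (a • tailPart p + b • tailPart s) w
  refine mem_regularNormalCone_of_le_sq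
    (smul_consVec_neg_mem_limitingNormalCone ha.le hb.le hw)
    (|κ| / 2 * (2 / a) ^ 2 + (‖tailPart p‖ + ‖tailPart s‖) * (2 / a)) ?_
  filter_upwards [eventually_fst_ne_zero (smul_consVec_one_ne_zero ha.ne' w),
    eventually_snd_ne_zero (neg_ne_zero.2 (smul_consVec_one_ne_zero hb.ne' (-w))),
    self_mem_nhdsWithin] with x h1 h2 hx
  obtain ⟨x₁, x₂⟩ := x
  rcases interior_or_ray_of_mem_limitingNormalCone hx h1 with h | ⟨a', b', w', ha', hb', hw', e1, e2⟩
  · exact absurd h.2 h2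
  have e1 : x₁ = _ := e1
  have e2 : x₂ = _ := e2
  subst e1 e2
  rw [← WithLp.toLp_sub]
  set D := ‖WithLp.toLp 2 ((a' • consVec 1 w', -(b' • consVec 1 (-w'))) -
    (a • consVec 1 w, -(b • consVec 1 (-w))))‖ with hD
  have hD1 : ‖a' • consVec 1 w' - a • consVec 1 w‖ ≤ D := norm_le_norm_toLp_left _ _
  have hD2 : ‖-(b' • consVec 1 (-w')) - -(b • consVec 1 (-w))‖ ≤ D := norm_le_norm_toLp_right _ _
  have hm : ‖w' - w‖ ≤ 2 / a * D :=
    (norm_sub_le_of_smul_consVec ha hw').trans (by gcongr)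
  have hA : |a' - a| ≤ D := by simpa using (abs_headPart_le _).trans hD1
  have hB : |b' - b| ≤ D := by
    have := (abs_headPart_le _).trans hD2
    simp only [headPart_sub, headPart_neg, headPart_smul, headPart_consVec, mul_one] at this
    rwa [← abs_neg, neg_sub']
  have hD0 : 0 ≤ D := norm_nonneg _
  have hww : inner ℝ w (w' - w) = -(‖w' - w‖ ^ 2 / 2) := by
    rw [norm_sub_sq_real, inner_sub_right, real_inner_self_eq_norm_sq, hw, hw',
      real_inner_comm w w']
    ring
  have hsum : inner ℝ (WithLp.toLp 2 (p, s)) (WithLp.toLp 2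
      ((a' • consVec 1 w', -(b' • consVec 1 (-w'))) -
        (a • consVec 1 w, -(b • consVec 1 (-w))))) =
      -(κ * (‖w' - w‖ ^ 2 / 2)) + (a' - a) * inner ℝ (tailPart p) (w' - w) +
        (b' - b) * inner ℝ (tailPart s) (w' - w) := by
    have h3 : inner ℝ (a • tailPart p + b • tailPart s) (w' - w) =
        -(κ * (‖w' - w‖ ^ 2 / 2)) := by
      rw [hk, inner_smul_left, hww]; simp
    rw [← h3]
    simp only [inner_eq_head_tail, headPart_consVec, tailPart_consVec, inner_neg_right] at hp hs
    simp only [WithLp.prod_inner_apply, Prod.fst_sub, Prod.snd_sub, inner_sub_right,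
      inner_neg_right, inner_smul_right, inner_eq_head_tail, headPart_consVec, tailPart_consVec,
      inner_add_left, inner_smul_left, conj_trivial]
    linear_combination (a' - a) * hp - (b' - b) * hs
  rw [hsum]
  have hm2 : ‖w' - w‖ ^ 2 ≤ (2 / a * D) ^ 2 := by gcongr
  have t1 : -(κ * (‖w' - w‖ ^ 2 / 2)) ≤ |κ| * ((2 / a * D) ^ 2 / 2) := by
    calc -(κ * (‖w' - w‖ ^ 2 / 2)) = -κ * (‖w' - w‖ ^ 2 / 2) := by ring
      _ ≤ |κ| * (‖w' - w‖ ^ 2 / 2) := by gcongr; exact neg_le_abs κ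
      _ ≤ _ := by gcongr
  have bilin : ∀ (c : ℝ) (x : EuclideanSpace ℝ (Fin r)), |c| ≤ D →
      c * inner ℝ x (w' - w) ≤ D * (‖x‖ * (2 / a * D)) := by
    intro c x hc
    refine (le_abs_self _).trans ?_
    rw [abs_mul]
    have := abs_real_inner_le_norm x (w' - w)
    gcongr
    exact this.trans (by gcongr)
  have t2 := bilin _ (tailPart p) hA
  have t3 := bilin _ (tailPart s) hB
  calc _ ≤ _ := add_le_add (add_le_add t1 t2) t3
    _ = _ := by ring

/-- The first component contributes a nonpositive term by self-duality. The second contributes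
nothing over the interior; on the boundary it gives `-b'⟪s, (1; -w)⟫ ≤ 0` plus `b'⟪s̄, w' - w⟫`,
which is quadratic because `b'` is itself bounded by the displacement. -/
theorem mem_regularNormalCone_of_smul_neg {s : EuclideanSpace ℝ (Fin (r + 1))}
    {a τ : ℝ} {w : EuclideanSpace ℝ (Fin r)} (ha : 0 < a) (hw : ‖w‖ = 1) (hτ : τ ≤ 0)
    (hs : 0 ≤ inner ℝ s (consVec 1 (-w))) :
    WithLp.toLp 2 (τ • consVec 1 (-w), s) ∈ regularNormalCone (normalGraph r)
      (WithLp.toLp 2 (a • consVec 1 w, 0)) := by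
  refine mem_regularNormalCone_of_le_sq
    (zero_mem_limitingNormalCone_secondOrderCone
      (smul_mem_secondOrderCone ha.le (consVec_mem_secondOrderCone hw)))
    (‖tailPart s‖ * (2 / a)) ?_
  filter_upwards [eventually_fst_ne_zero (smul_consVec_one_ne_zero ha.ne' w),
    self_mem_nhdsWithin] with x h1 hx
  obtain ⟨x₁, x₂⟩ := x
  have hx₁ : x₁ ∈ secondOrderCone r := (mem_limitingNormalCone_secondOrderCone.1 hx).1
  have hn : 0 ≤ inner ℝ (consVec 1 (-w)) x₁ := inner_nonneg_of_mem_secondOrderCone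
    (consVec_mem_secondOrderCone (by simpa using hw)) hx₁
  have h0 : inner ℝ (consVec 1 (-w)) (consVec 1 w) = 0 := by
    simp [inner_eq_head_tail, hw]
  have hfst : inner ℝ (τ • consVec 1 (-w)) (x₁ - a • consVec 1 w) ≤ 0 := by
    rw [inner_sub_right, inner_smul_right, inner_smul_left, inner_smul_left, h0]
    simpa using mul_nonpos_of_nonpos_of_nonneg hτ hn
  rw [← WithLp.toLp_sub]
  set D := ‖WithLp.toLp 2 ((x₁, x₂) - (a • consVec 1 w, 0))‖ with hD
  have hD1 : ‖x₁ - a • consVec 1 w‖ ≤ D := norm_le_norm_toLp_left _ _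
  have hD2 : ‖x₂‖ ≤ D := by
    have h : ‖x₂ - 0‖ ≤ D := norm_le_norm_toLp_right _ _
    rwa [sub_zero] at h
  have hD0 : 0 ≤ D := norm_nonneg _
  have hsnd : inner ℝ s x₂ ≤ ‖tailPart s‖ * (2 / a) * D ^ 2 := by
    rcases interior_or_ray_of_mem_limitingNormalCone hx h1 with h | h
    · have e : x₂ = 0 := h.2
      rw [e, inner_zero_right]
      positivity
    · obtain ⟨a', b', w', ha', hb', hw', e1, e2⟩ := h
      have e1 : x₁ = _ := e1
      have e2 : x₂ = _ := e2
      have hm : ‖w' - w‖ ≤ 2 / a * D :=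
        (norm_sub_le_of_smul_consVec ha hw').trans (by rw [← e1]; gcongr)
      have hB : b' ≤ D := by
        have := (abs_headPart_le x₂).trans hD2
        rw [e2] at this
        simpa [abs_of_nonneg hb'] using this
      have hi : inner ℝ s x₂ = -(b' * inner ℝ s (consVec 1 (-w))) +
          b' * inner ℝ (tailPart s) (w' - w) := by
        rw [e2]
        simp only [inner_neg_right, inner_smul_right, inner_eq_head_tail, headPart_consVec,
          tailPart_consVec, inner_sub_right]
        ring
      have h3 : b' * inner ℝ (tailPart s) (w' - w) ≤ D * (‖tailPart s‖ * (2 / a * D)) := by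
        have := real_inner_le_norm (tailPart s) (w' - w)
        calc _ ≤ b' * (‖tailPart s‖ * (2 / a * D)) := by
              gcongr
              exact this.trans (by gcongr)
          _ ≤ _ := by gcongr
      have h4 := mul_nonneg hb' hs
      rw [hi]
      calc _ ≤ D * (‖tailPart s‖ * (2 / a * D)) := by linarith
        _ = _ := by ring
  have e : inner ℝ (WithLp.toLp 2 (τ • consVec 1 (-w), s))
      (WithLp.toLp 2 ((x₁, x₂) - (a • consVec 1 w, 0))) =
      inner ℝ (τ • consVec 1 (-w)) (x₁ - a • consVec 1 w) + inner ℝ s x₂ := by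
    simp [WithLp.prod_inner_apply]
  rw [e]
  linarith

end NormalGraphSufficient

/-! ### Coderivatives: passing to limits of regular normals. -/

section CoderivativeFormulas

variable {r : ℕ}

@[fun_prop] theorem Continuous.consVec {X : Type*} [TopologicalSpace X] {f : X → ℝ}
    {g : X → EuclideanSpace ℝ (Fin r)} (hf : Continuous f) (hg : Continuous g) :
    Continuous (fun x => consVec (f x) (g x)) :=
  continuous_consVec.comp (hf.prodMk hg)

theorem exists_seq_of_mem_coderivNormalSOC {u v p q : EuclideanSpace ℝ (Fin (r + 1))}
    (h : p ∈ coderivNormalSOC u v q) :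
    ∃ y z p' s : ℕ → EuclideanSpace ℝ (Fin (r + 1)), Tendsto y atTop (𝓝 u) ∧
      Tendsto z atTop (𝓝 v) ∧ Tendsto p' atTop (𝓝 p) ∧ Tendsto s atTop (𝓝 (-q)) ∧
      ∀ k, WithLp.toLp 2 (p' k, s k) ∈
        regularNormalCone (normalGraph r) (WithLp.toLp 2 (y k, z k)) := by
  obtain ⟨-, x, n, hx, hn, h⟩ := h
  have c1 : Continuous (fun x : WithLp 2 (EuclideanSpace ℝ (Fin (r + 1)) ×
    EuclideanSpace ℝ (Fin (r + 1))) => x.fst) := by fun_prop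
  have c2 : Continuous (fun x : WithLp 2 (EuclideanSpace ℝ (Fin (r + 1)) ×
    EuclideanSpace ℝ (Fin (r + 1))) => x.snd) := by fun_prop
  exact ⟨fun k => (x k).fst, fun k => (x k).snd, fun k => (n k).fst, fun k => (n k).snd,
    (c1.tendsto _).comp hx, (c2.tendsto _).comp hx, (c1.tendsto _).comp hn,
    (c2.tendsto _).comp hn, h⟩

/-- Sampling a curve at `t = 1/(k + 1)` yields the sequences; `q` can stay fixed in every
approximation needed here. -/
theorem mem_coderivNormalSOC_of_tendsto {u v p q : EuclideanSpace ℝ (Fin (r + 1))}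
    (hv : v ∈ limitingNormalCone (secondOrderCone r) u)
    {γ : ℝ → EuclideanSpace ℝ (Fin (r + 1)) × EuclideanSpace ℝ (Fin (r + 1)) ×
      EuclideanSpace ℝ (Fin (r + 1))} (hγ : Continuous γ) (h0 : γ 0 = (u, v, p))
    (h : ∀ t, 0 < t → WithLp.toLp 2 ((γ t).2.2, -q) ∈
      regularNormalCone (normalGraph r) (WithLp.toLp 2 ((γ t).1, (γ t).2.1))) :
    p ∈ coderivNormalSOC u v q := by
  have ht := tendsto_one_div_add_atTop_nhds_zero_nat (𝕜 := ℝ)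
  refine ⟨hv, fun k => WithLp.toLp 2 ((γ (1 / ((k : ℝ) + 1))).1, (γ (1 / ((k : ℝ) + 1))).2.1),
    fun k => WithLp.toLp 2 ((γ (1 / ((k : ℝ) + 1))).2.2, -q), ?_, ?_,
    fun k => h _ (by positivity)⟩
  · have c : Continuous (fun t => WithLp.toLp 2 ((γ t).1, (γ t).2.1)) := by fun_prop
    simpa [h0, Function.comp_def] using (c.tendsto 0).comp ht
  · have c : Continuous (fun t => WithLp.toLp 2 ((γ t).2.2, -q)) := by fun_prop
    simpa [h0, Function.comp_def] using (c.tendsto 0).comp ht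

theorem mem_coderivNormalSOC_of_regular {u v p q : EuclideanSpace ℝ (Fin (r + 1))}
    (h : WithLp.toLp 2 (p, -q) ∈ regularNormalCone (normalGraph r) (WithLp.toLp 2 (u, v))) :
    p ∈ coderivNormalSOC u v q :=
  regularNormalCone_subset_limitingNormalCone _ _ h

theorem mem_coderivNormalSOC_interior_iff {u p q : EuclideanSpace ℝ (Fin (r + 1))}
    (hu : u ∈ interior (secondOrderCone r)) : p ∈ coderivNormalSOC u 0 q ↔ p = 0 := by
  constructor
  · intro h
    obtain ⟨y, z, p', s, hy, -, hp, -, h⟩ := exists_seq_of_mem_coderivNormalSOC h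
    refine tendsto_nhds_unique hp (tendsto_const_nhds.congr' ?_)
    filter_upwards [hy.eventually (isOpen_interior.mem_nhds hu)] with k hk
    exact (fst_eq_zero_of_mem_regularNormalCone hk (h k)).symm
  · rintro rfl
    exact mem_coderivNormalSOC_of_regular (mem_regularNormalCone_of_mem_interior hu _)

/-- The regular normals to `normalGraph` away from the vertex. -/
theorem regularNormalCone_normalGraph_cases {y z p s : EuclideanSpace ℝ (Fin (r + 1))}
    (hy : y ≠ 0)
    (h : WithLp.toLp 2 (p, s) ∈ regularNormalCone (normalGraph r) (WithLp.toLp 2 (y, z))) :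
    SmoothNormal (headPart y) (-headPart z) (unitVec (tailPart y)) p s ∨
      z = 0 ∧ (p = 0 ∨ p = headPart p • consVec 1 (-unitVec (tailPart y)) ∧ headPart p ≤ 0 ∧
        0 ≤ inner ℝ s (consVec 1 (-unitVec (tailPart y)))) := by
  rcases interior_or_ray_of_mem_limitingNormalCone h.1 hy with
    ⟨h1, h2⟩ | ⟨a, b, w, ha, hb, hw, e1, e2⟩
  · exact .inr ⟨h2, .inl (fst_eq_zero_of_mem_regularNormalCone h1 h)⟩
  have e1 : y = _ := e1
  have e2 : z = _ := e2
  subst e1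
  have ew : unitVec (tailPart (a • consVec 1 w)) = w := by
    rw [tailPart_smul, tailPart_consVec, unitVec_smul ha hw]
  rw [ew]
  rcases hb.eq_or_lt with rfl | hb
  · have e2 : z = 0 := by simpa using e2
    subst e2
    refine .inr ⟨rfl, .inr ?_⟩
    have hs := inner_snd_nonneg_of_mem_regularNormalCone ha.le hw h
    -- `p` is normal to `Q` at a boundary point with direction `w`, so the description of the graph
    -- applies to `p` and makes it zero or a multiple of `(1; -w)`.
    have hp := regularNormalCone_subset_limitingNormalCone _ _ (fst_mem_regularNormalCone h)
    rcases interior_or_ray_of_mem_limitingNormalCone hp hy with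
      ⟨h1, h2⟩ | ⟨a', b', w', ha', hb', hw', e3, e4⟩
    · subst h2
      exact ⟨by simp, by simp, hs⟩
    · have : w' = w := by
        rw [← unitVec_smul ha' hw', ← tailPart_consVec 1 w', ← tailPart_smul, ← e3, ew]
      subst this
      rw [e4]
      exact ⟨by simp, by simpa using hb', hs⟩
  · subst e2
    left
    simpa using smoothNormal_of_mem_regularNormalCone ha hb hw h

theorem isClosed_smoothNormal :
    IsClosed {x : ℝ × ℝ × EuclideanSpace ℝ (Fin r) × EuclideanSpace ℝ (Fin (r + 1)) ×
      EuclideanSpace ℝ (Fin (r + 1)) | SmoothNormal x.1 x.2.1 x.2.2.1 x.2.2.2.1 x.2.2.2.2} := by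
  unfold SmoothNormal
  exact (isClosed_eq (by fun_prop) (by fun_prop)).inter
    ((isClosed_eq (by fun_prop) (by fun_prop)).inter (isClosed_eq (by fun_prop) (by fun_prop)))

theorem tendsto_unitVec_tailPart {ι : Type*} {l : Filter ι}
    {y : ι → EuclideanSpace ℝ (Fin (r + 1))} {a : ℝ} {w : EuclideanSpace ℝ (Fin r)}
    (ha : 0 < a) (hw : ‖w‖ = 1) (hy : Tendsto y l (𝓝 (a • consVec 1 w))) :
    Tendsto (fun k => unitVec (tailPart (y k))) l (𝓝 w) := by
  have h1 : Tendsto (fun k => tailPart (y k)) l (𝓝 (a • w)) := by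
    simpa [Function.comp_def] using (continuous_tailPart.tendsto _).comp hy
  have h0 : a • w ≠ 0 := by
    rw [← norm_ne_zero_iff, norm_smul, hw]; simpa using ha.ne'
  have := (continuousAt_unitVec h0).tendsto.comp h1
  rwa [unitVec_smul ha hw] at this

/-- Near such a point both components are nonzero, so only the smooth piece occurs. Its parameters
depend continuously on the point and its equations are closed, so limits add no new normals. -/
theorem mem_coderivNormalSOC_iff_smoothNormal {a b : ℝ} {w : EuclideanSpace ℝ (Fin r)}
    (ha : 0 < a) (hb : 0 < b) (hw : ‖w‖ = 1) {p q : EuclideanSpace ℝ (Fin (r + 1))} :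
    p ∈ coderivNormalSOC (a • consVec 1 w) (-(b • consVec 1 (-w))) q ↔
      SmoothNormal a b w p (-q) := by
  constructor
  · intro h
    obtain ⟨y, z, p', s, hy, hz, hp, hs, h⟩ := exists_seq_of_mem_coderivNormalSOC h
    have ha' : Tendsto (fun k => headPart (y k)) atTop (𝓝 a) := by
      simpa [Function.comp_def] using (continuous_headPart.tendsto _).comp hy
    have hb' : Tendsto (fun k => -headPart (z k)) atTop (𝓝 b) := by
      simpa using ((continuous_headPart.tendsto _).comp hz).neg
    have hlim := ha'.prodMk_nhds (hb'.prodMk_nhds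
      ((tendsto_unitVec_tailPart ha hw hy).prodMk_nhds (hp.prodMk_nhds hs)))
    refine isClosed_smoothNormal.mem_of_tendsto hlim ?_
    filter_upwards [hy.eventually_ne (smul_consVec_one_ne_zero ha.ne' w),
      hz.eventually_ne (neg_ne_zero.2 (smul_consVec_one_ne_zero hb.ne' (-w)))] with k h1 h2
    rcases regularNormalCone_normalGraph_cases h1 (h k) with h | h
    · exact h
    · exact absurd h.1 h2
  · intro h
    exact mem_coderivNormalSOC_of_regular (mem_regularNormalCone_of_smoothNormal ha hb hw h)

/-- The third equation reads `a p̄ - b q̄ = κ w`, which gives `p̄` with `τ = κ/a`; then `⟪p, (1; w)⟫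
= 0` and `q̇ = ⟪q̄, w⟫` determine `ṗ`. -/
theorem smoothNormal_neg_iff {a b : ℝ} {w : EuclideanSpace ℝ (Fin r)} (ha : 0 < a)
    (hw : ‖w‖ = 1) {p q : EuclideanSpace ℝ (Fin (r + 1))} :
    SmoothNormal a b w p (-q) ↔ inner ℝ q (consVec 1 (-w)) = 0 ∧
      ∃ τ : ℝ, p = consVec (-b / a * headPart q - τ) (-(-b / a) • tailPart q + τ • w) := by
  have hww : inner ℝ w w = (1 : ℝ) := by rw [real_inner_self_eq_norm_sq, hw]; norm_num
  simp only [SmoothNormal, inner_neg_left, neg_eq_zero]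
  constructor
  · rintro ⟨hp, hq, hk⟩
    refine ⟨hq, inner ℝ (a • tailPart p + b • tailPart (-q)) w / a, ?_⟩
    set κ := inner ℝ (a • tailPart p + b • tailPart (-q)) w
    have ht : tailPart p = -(-b / a) • tailPart q + (κ / a) • w := by
      have h1 : a • tailPart p = b • tailPart q + κ • w := by
        rw [← hk, tailPart_neg]; module
      rw [← inv_smul_smul₀ ha.ne' (tailPart p), h1]
      module
    simp only [inner_eq_head_tail, headPart_consVec, tailPart_consVec, inner_neg_right] at hp hq
    refine ext_head_tail ?_ (by rw [ht, tailPart_consVec])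
    rw [ht, inner_add_left, inner_smul_left, inner_smul_left, hww] at hp
    simp only [conj_trivial] at hp
    rw [headPart_consVec]
    linear_combination hp + (b / a) * hq
  · rintro ⟨hq, τ, rfl⟩
    have hq' := hq
    simp only [inner_eq_head_tail, headPart_consVec, tailPart_consVec, inner_neg_right] at hq'
    refine ⟨?_, hq, ?_⟩
    · simp only [inner_eq_head_tail, headPart_consVec, tailPart_consVec, inner_add_left,
        inner_smul_left, hww, conj_trivial]
      linear_combination (-b / a) * hq'
    · have : a • tailPart (consVec (-b / a * headPart q - τ)
          (-(-b / a) • tailPart q + τ • w)) + b • tailPart (-q) = (a * τ) • w := by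
        rw [tailPart_consVec, tailPart_neg]
        match_scalars
        · field_simp; ring
        · ring
      rw [this, inner_smul_left, hww]
      simp

/-- The coderivative at a boundary point of the cone and the zero normal. -/
theorem mem_coderivNormalSOC_boundary_zero_iff {a : ℝ} {w : EuclideanSpace ℝ (Fin r)}
    (ha : 0 < a) (hw : ‖w‖ = 1) {p q : EuclideanSpace ℝ (Fin (r + 1))} :
    p ∈ coderivNormalSOC (a • consVec 1 w) 0 q ↔
      ∃ τ : ℝ, p = τ • consVec 1 (-w) ∧ (0 < inner ℝ (consVec 1 (-w)) q → τ = 0) ∧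
        (inner ℝ (consVec 1 (-w)) q < 0 → τ ≤ 0) := by
  have hmem : a • consVec 1 w ∈ secondOrderCone r :=
    smul_mem_secondOrderCone ha.le (consVec_mem_secondOrderCone hw)
  constructor
  · intro h
    obtain ⟨y, z, p', s, hy, hz, hp, hs, h⟩ := exists_seq_of_mem_coderivNormalSOC h
    have ha' : Tendsto (fun k => headPart (y k)) atTop (𝓝 a) := by
      simpa [Function.comp_def] using (continuous_headPart.tendsto _).comp hy
    have hb' : Tendsto (fun k => -headPart (z k)) atTop (𝓝 0) := by
      simpa using ((continuous_headPart.tendsto _).comp hz).neg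
    have hlim := ha'.prodMk_nhds (hb'.prodMk_nhds
      ((tendsto_unitVec_tailPart ha hw hy).prodMk_nhds (hp.prodMk_nhds hs)))
    have c₁ : IsClosed {x : ℝ × ℝ × EuclideanSpace ℝ (Fin r) ×
        EuclideanSpace ℝ (Fin (r + 1)) × EuclideanSpace ℝ (Fin (r + 1)) |
        x.2.2.2.1 = 0} :=
      isClosed_eq (by fun_prop) (by fun_prop)
    have c₂ : IsClosed {x : ℝ × ℝ × EuclideanSpace ℝ (Fin r) ×
        EuclideanSpace ℝ (Fin (r + 1)) × EuclideanSpace ℝ (Fin (r + 1)) |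
        x.2.2.2.1 = headPart x.2.2.2.1 • consVec 1 (-x.2.2.1)} :=
      isClosed_eq (by fun_prop) (by fun_prop)
    have c₃ : IsClosed {x : ℝ × ℝ × EuclideanSpace ℝ (Fin r) ×
        EuclideanSpace ℝ (Fin (r + 1)) × EuclideanSpace ℝ (Fin (r + 1)) |
        headPart x.2.2.2.1 ≤ 0} :=
      isClosed_le (by fun_prop) (by fun_prop)
    have c₄ : IsClosed {x : ℝ × ℝ × EuclideanSpace ℝ (Fin r) ×
        EuclideanSpace ℝ (Fin (r + 1)) × EuclideanSpace ℝ (Fin (r + 1)) |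
        0 ≤ inner ℝ x.2.2.2.2 (consVec 1 (-x.2.2.1))} :=
      isClosed_le (by fun_prop) (by fun_prop)
    have hmemlim := (isClosed_smoothNormal.union (c₁.union (c₂.inter (c₃.inter c₄)))).mem_of_tendsto hlim (by
      filter_upwards [hy.eventually_ne (smul_consVec_one_ne_zero ha.ne' w)] with k h1
      exact (regularNormalCone_normalGraph_cases h1 (h k)).imp id And.right)
    rcases hmemlim with h | h | h
    -- The smooth equations survive with `b = 0`: they force `⟪q, (1; -w)⟫ = 0` and leave a multiple
    -- of `(1; -w)` of either sign.
    · obtain ⟨hq, τ, hτ⟩ := (smoothNormal_neg_iff ha hw).1 h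
      refine ⟨-τ, ?_, fun h => ?_, fun h => ?_⟩
      · have hτ : p = _ := hτ
        rw [hτ]
        refine ext_head_tail ?_ ?_ <;> simp
      · rw [real_inner_comm] at h; exact absurd hq h.ne'
      · rw [real_inner_comm] at h; exact absurd hq h.ne
    · have h : p = 0 := h
      exact ⟨0, by simpa using h, fun _ => rfl, fun _ => le_rfl⟩
    · obtain ⟨h1, h2, h3⟩ := h
      have h3 : 0 ≤ inner ℝ (-q) (consVec 1 (-w)) := h3
      rw [inner_neg_left, real_inner_comm] at h3
      exact ⟨headPart p, h1, fun h => by linarith, fun _ => h2⟩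
  · rintro ⟨τ, rfl, h1, h2⟩
    -- Three sources of normals: limits from the interior give `0`; limits from the smooth piece
    -- with `b = t → 0` give the whole line; regular normals at the point give the half-line.
    rcases lt_trichotomy 0 (inner ℝ (consVec 1 (-w)) q) with h | h | h
    · rw [h1 h, zero_smul]
      refine mem_coderivNormalSOC_of_tendsto (zero_mem_limitingNormalCone_secondOrderCone hmem)
        (γ := fun t => (a • consVec 1 w + t • consVec 1 0, 0, 0)) (by fun_prop) (by simp)
        fun t ht => mem_regularNormalCone_of_mem_interior ?_ _
      rw [interior_secondOrderCone]
      show ‖tailPart _‖ < headPart _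
      simp [norm_smul, hw, abs_of_pos ha, ht]
    · have hq : inner ℝ q (consVec 1 (-w)) = 0 := by rw [real_inner_comm, ← h]
      have hq' := hq
      simp only [inner_eq_head_tail, headPart_consVec, tailPart_consVec, inner_neg_right] at hq'
      refine mem_coderivNormalSOC_of_tendsto (zero_mem_limitingNormalCone_secondOrderCone hmem)
        (γ := fun t => (a • consVec 1 w, -(t • consVec 1 (-w)),
          consVec (-t / a * headPart q - -τ) (-(-t / a) • tailPart q + (-τ) • w)))
        (by fun_prop) ?_ fun t ht => mem_regularNormalCone_of_smoothNormal ha ht hw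
          ((smoothNormal_neg_iff ha hw).2 ⟨hq, -τ, rfl⟩)
      simp only [zero_smul, neg_zero, zero_div, zero_mul, Prod.mk.injEq, true_and]
      refine ext_head_tail ?_ ?_ <;> simp
    · refine mem_coderivNormalSOC_of_regular
        (mem_regularNormalCone_of_smul_neg ha hw (h2 h) ?_)
      rw [inner_neg_left, real_inner_comm]
      linarith

/-- By self-duality `⟪p, y⟫ ≤ 0 ≤ ⟪q, z⟫` on the whole graph, so the pair is already a regular
normal, with constant 0. -/
theorem mem_coderivNormalSOC_zero_zero_of_mem_neg {p q : EuclideanSpace ℝ (Fin (r + 1))}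
    (hp : p ∈ -secondOrderCone r) (hq : q ∈ -secondOrderCone r) :
    p ∈ coderivNormalSOC 0 0 q := by
  refine mem_coderivNormalSOC_of_regular (mem_regularNormalCone_of_le_sq
    (zero_mem_limitingNormalCone_secondOrderCone (by simp [secondOrderCone])) 0 ?_)
  filter_upwards [self_mem_nhdsWithin] with x hx
  obtain ⟨h1, h2, -⟩ := mem_limitingNormalCone_secondOrderCone.1 hx
  have h3 := inner_nonneg_of_mem_secondOrderCone hp h1
  have h4 := inner_nonneg_of_mem_secondOrderCone hq h2
  obtain ⟨x₁, x₂⟩ := x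
  simp at h3 h4
  simp [WithLp.prod_inner_apply, ← WithLp.toLp_sub]
  linarith

/-- Write `p = -c(1; w)` and approach the vertex along the boundary ray `t(1; -w)` with `z = 0`: the
pair `(p, -q)` is a regular normal at every point of it. -/
theorem mem_coderivNormalSOC_zero_zero_of_mem_frontier {p q : EuclideanSpace ℝ (Fin (r + 1))}
    (hp : p ∈ (-frontier (secondOrderCone r)) \ {0}) (hpq : 0 ≤ inner ℝ p q) :
    p ∈ coderivNormalSOC 0 0 q := by
  obtain ⟨c, w, hc, hw, e⟩ := exists_eq_smul_of_mem_frontier (u := -p)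
    ⟨hp.1, by simpa using hp.2⟩
  have hp' : p = (-c) • consVec 1 (- -w) := by rw [neg_neg, neg_smul, ← e, neg_neg]
  refine mem_coderivNormalSOC_of_tendsto
    (zero_mem_limitingNormalCone_secondOrderCone (by simp [secondOrderCone]))
    (γ := fun t => (t • consVec 1 (-w), 0, p)) (by fun_prop) (by simp) fun t ht => ?_
  have hw' : ‖-w‖ = 1 := by simpa using hw
  dsimp only
  rw [hp']
  refine mem_regularNormalCone_of_smul_neg ht hw' (by linarith) ?_
  rw [hp', inner_smul_left] at hpq
  simp only [conj_trivial] at hpq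
  rw [inner_neg_left, real_inner_comm]
  nlinarith

/-- The vertex is approached through the interior, along the axis `(t; 0)`. -/
theorem zero_mem_coderivNormalSOC_zero_zero (q : EuclideanSpace ℝ (Fin (r + 1))) :
    0 ∈ coderivNormalSOC 0 0 q := by
  refine mem_coderivNormalSOC_of_tendsto
    (zero_mem_limitingNormalCone_secondOrderCone (by simp [secondOrderCone]))
    (γ := fun t => (t • consVec 1 0, 0, 0)) (by fun_prop) (by simp)
    fun t ht => mem_regularNormalCone_of_mem_interior ?_ _
  rw [interior_secondOrderCone]
  show ‖tailPart _‖ < headPart _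
  simpa using ht

end CoderivativeFormulas

/-! ### Assembly of the six cases. -/

theorem lemma3p2 (r : ℕ) (hr : 1 ≤ r) (u v : EuclideanSpace ℝ (Fin (r + 1)))
    (hu : u ∈ secondOrderCone r) (hv : v ∈ limitingNormalCone (secondOrderCone r) u) :
    -- (1)
    (u = 0 → v ∈ -interior (secondOrderCone r) →
      coderivNormalSOC u v 0 = Set.univ ∧ ∀ q, q ≠ 0 → coderivNormalSOC u v q = ∅) ∧
    -- (2)
    (u ∈ interior (secondOrderCone r) → v = 0 → ∀ q, coderivNormalSOC u v q = {0}) ∧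
    -- (3)
    (u ∈ frontier (secondOrderCone r) \ {0} → v ∈ (-frontier (secondOrderCone r)) \ {0} →
      ∀ q,
        (inner ℝ q v = 0 → coderivNormalSOC u v q =
          {p | ∃ τ : ℝ, p = consVec (headPart v / headPart u * headPart q - τ)
            (-(headPart v / headPart u) • tailPart q + τ • unitVec (tailPart u))}) ∧
        (inner ℝ q v ≠ 0 → coderivNormalSOC u v q = ∅)) ∧
    -- (4)
    (u ∈ frontier (secondOrderCone r) \ {0} → v = 0 →
      ∀ q, coderivNormalSOC u v q =
        {p | ∃ τ : ℝ, p = τ • consVec 1 (-unitVec (tailPart u)) ∧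
          (0 < inner ℝ (consVec 1 (-unitVec (tailPart u))) q → τ = 0) ∧
          (inner ℝ (consVec 1 (-unitVec (tailPart u))) q < 0 → τ ≤ 0)}) ∧
    -- (5)
    (u = 0 → v ∈ (-frontier (secondOrderCone r)) \ {0} →
      ∀ q,
        (∀ τ : ℝ, q = τ • consVec 1 (unitVec (tailPart v)) → coderivNormalSOC u v q =
          {p | (0 < τ → inner ℝ p q = 0) ∧ (τ < 0 → 0 ≤ inner ℝ p q)}) ∧
        ((¬ ∃ τ : ℝ, q = τ • consVec 1 (unitVec (tailPart v))) →
          coderivNormalSOC u v q = ∅)) ∧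
    -- (6)
    (u = 0 → v = 0 →
      -- (6a)
      coderivNormalSOC u v 0 = Set.univ ∧
      -- (6b)
      (∀ p q, p ∈ -secondOrderCone r → q ∈ -secondOrderCone r → p ∈ coderivNormalSOC u v q) ∧
      -- (6c)
      (∀ p q, p ∈ (-frontier (secondOrderCone r)) \ {0} → 0 ≤ inner ℝ p q →
        p ∈ coderivNormalSOC u v q) ∧
      -- (6d)
      (∀ p q, q ∈ (-frontier (secondOrderCone r)) \ {0} → 0 ≤ inner ℝ p q →
        p ∈ coderivNormalSOC u v q) ∧
      -- (6e)
      (∀ q, (0 : EuclideanSpace ℝ (Fin (r + 1))) ∈ coderivNormalSOC u v q)) := by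
  have mem_neg_frontier : ∀ x : EuclideanSpace ℝ (Fin (r + 1)),
      x ∈ (-frontier (secondOrderCone r)) \ {0} → -x ∈ frontier (secondOrderCone r) \ {0} :=
    fun x hx => ⟨hx.1, by simpa using hx.2⟩
  refine ⟨?_, ?_, ?_, ?_, ?_, ?_⟩
  · rintro rfl hvi
    -- The symmetry moves the base point to `(-v, 0)` with `-v` interior, and exchanges `p` with
    -- `q`.
    have key : ∀ p q, p ∈ coderivNormalSOC 0 v q ↔ q = 0 := fun p q => by
      rw [mem_coderivNormalSOC_swap_iff, neg_zero, mem_coderivNormalSOC_interior_iff hvi]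
    refine ⟨Set.eq_univ_of_forall fun p => (key p 0).2 rfl, fun q hq => ?_⟩
    exact Set.eq_empty_of_forall_notMem fun p hp => hq ((key p q).1 hp)
  · rintro hui rfl q
    ext p
    exact mem_coderivNormalSOC_interior_iff hui
  · intro huf hvf q
    rcases interior_or_ray_of_mem_limitingNormalCone hv huf.2 with
      h | ⟨a, b, w, ha, hb, hw, rfl, rfl⟩
    · exact absurd h.2 hvf.2
    have hb : 0 < b := lt_of_le_of_ne hb fun h => hvf.2 (by simp [← h])
    have hiff : inner ℝ q (-(b • consVec 1 (-w))) = 0 ↔ inner ℝ q (consVec 1 (-w)) = 0 := by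
      rw [inner_neg_right, inner_smul_right, neg_eq_zero, mul_eq_zero, or_iff_right hb.ne']
    have hmem := fun p => (mem_coderivNormalSOC_iff_smoothNormal ha hb hw (p := p) (q := q)).trans
      (smoothNormal_neg_iff ha hw)
    refine ⟨fun h => Set.ext fun p => ?_, fun h => Set.eq_empty_of_forall_notMem fun p hp =>
      h (hiff.2 ((hmem p).1 hp).1)⟩
    rw [hmem, and_iff_right (hiff.1 h), tailPart_smul, tailPart_consVec, unitVec_smul ha hw]
    simp
  · rintro huf rfl q
    obtain ⟨a, w, ha, hw, rfl⟩ := exists_eq_smul_of_mem_frontier huf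
    ext p
    rw [mem_coderivNormalSOC_boundary_zero_iff ha hw, tailPart_smul, tailPart_consVec,
      unitVec_smul ha hw]
    rfl
  · rintro rfl hvf q
    obtain ⟨a, w, ha, hw, e⟩ := exists_eq_smul_of_mem_frontier (mem_neg_frontier v hvf)
    have hwv : unitVec (tailPart v) = -w := by
      rw [← neg_neg v, e, tailPart_neg, unitVec_neg, tailPart_smul, tailPart_consVec,
        unitVec_smul ha hw]
    -- After the symmetry this is the boundary point `-v` with zero normal; now `q` must lie on the
    -- line and `p` decides the admissible signs of `τ`. The rest inverts that dependence.
    have hmem : ∀ p, p ∈ coderivNormalSOC 0 v q ↔ ∃ τ : ℝ, q = τ • consVec 1 (-w) ∧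
        (0 < inner ℝ (consVec 1 (-w)) p → τ = 0) ∧
        (inner ℝ (consVec 1 (-w)) p < 0 → τ ≤ 0) := fun p => by
      rw [mem_coderivNormalSOC_swap_iff, neg_zero, e,
        mem_coderivNormalSOC_boundary_zero_iff ha hw]
    rw [hwv]
    refine ⟨fun τ hτ => Set.ext fun p => ?_, fun h => Set.eq_empty_of_forall_notMem fun p hp =>
      h (((hmem p).1 hp).imp fun _ h => h.1)⟩
    have huniq : ∀ σ : ℝ, q = σ • consVec 1 (-w) ↔ σ = τ := fun σ =>
      ⟨fun h => by simpa using congrArg headPart (h.symm.trans hτ), fun h => h ▸ hτ⟩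
    simp only [hmem, huniq, exists_eq_left]
    rw [Set.mem_ofPred_eq, hτ, inner_smul_right, real_inner_comm]
    constructor
    · rintro ⟨h1, h2⟩
      refine ⟨fun h => ?_, fun h => ?_⟩
      · rcases lt_trichotomy 0 (inner ℝ p (consVec 1 (-w))) with h3 | h3 | h3
        · exact absurd (h1 h3) h.ne'
        · rw [← h3, mul_zero]
        · exact absurd (h2 h3) h.not_ge
      · refine mul_nonneg_of_nonpos_of_nonpos h.le (not_lt.1 fun h3 => h.ne (h1 h3))
    · rintro ⟨h1, h2⟩
      refine ⟨fun h => ?_, fun h => not_lt.1 fun h3 => ?_⟩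
      · by_contra hne
        rcases lt_or_gt_of_ne hne with h3 | h3
        · exact absurd (h2 h3) (mul_neg_of_neg_of_pos h3 h).not_ge
        · exact (mul_pos h3 h).ne' (h1 h3)
      · exact (mul_neg_of_pos_of_neg h3 h).ne (h1 h3)
  · rintro rfl rfl
    -- The point `(0, 0)` is fixed by the symmetry, so (6a) mirrors (6e) and (6d) mirrors (6c).
    have swap : ∀ {p q : EuclideanSpace ℝ (Fin (r + 1))},
        q ∈ coderivNormalSOC 0 0 p → p ∈ coderivNormalSOC 0 0 q := fun {p q} h => by
      simpa using mem_coderivNormalSOC_swap h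
    refine ⟨Set.eq_univ_of_forall fun p => swap (zero_mem_coderivNormalSOC_zero_zero p),
      fun p q => mem_coderivNormalSOC_zero_zero_of_mem_neg,
      fun p q => mem_coderivNormalSOC_zero_zero_of_mem_frontier, fun p q hq hpq => ?_,
      zero_mem_coderivNormalSOC_zero_zero⟩
    rw [real_inner_comm] at hpq
    exact swap (mem_coderivNormalSOC_zero_zero_of_mem_frontier hq hpq)
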